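/- Let $q$ be an indeterminate, $[j]=(q^j-q^{-j})/(q-q^{-1})$ for $j\in\mathbb Z$, $[k]!=[1]\cdots[k]$, and let $U_q(\mathfrak{sl}_2)$ be the $\mathbb C(q)$-algebra with generators $E,F,K^{\pm1}$ and relations $KEK^{-1}=q^2E$, $KFK^{-1}=q^{-2}F$, $EF-FE=(K-K^{-1})/(q-q^{-1})$, with comultiplication $\Delta(E)=E\otimes K^{-1}+1\otimes E$, $\Delta(F)=F\otimes1+K\otimes F$, $\Delta(K)=K\otimes K$. Let $V_a$ ($a\ge1$) be the irreducible representation with canonical basis $v_k$, $k\in\{a,a-2,\dots,-a\}$, where $Kv_k=q^kv_k$, $Ev_k=[\frac{a+k}2+1]v_{k+2}$, $Fv_k=[\frac{a-k}2+1]v_{k-2}$, and let $v^k$ be the basis dual to $v_k$ for the symmetric form with $\langle v_a,v_a\rangle=1$ for which $E$ and $F$ are adjoint and $K$ is self-adjoint. Let $\mathbf m=(m_1,\dots,m_n)$ be positive integers, $V=V_{m_1}\otimes\cdots\otimes V_{m_n}$, and let $I_{\mathbf m}$ be the set of $\mathbf k=(k_1,\dots,k_n)$ with $-m_i\le k_i\le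 m_i$, $k_i\equiv m_i \pmod 2$. Let $Y=F+q^{-1}KE+K$, the generator of a coideal subalgebra, act on $V$. The dual canonical basis $v^{k_1}\spadesuit\cdots\spadesuit v^{k_n}$ $(\mathbf k\in I_{\mathbf m})$ of $V$ is characterized by: each element is fixed by $\psi^\iota_-=\Upsilon_-\circ\psi_-$, and its difference with $v^{k_1}\otimes\cdots\otimes v^{k_n}$ has coordinates in $q^{-1}\mathbb Z[q^{-1}]$ with respect to the standard basis $(v^{l_1}\otimes\cdots\otimes v^{l_n})_{\mathbf l\in I_{\mathbf m}}$. Here $\psi_-$ is the antilinear ($q\mapsto q^{-1}$) map that fixes each $v^k$ on a single factor and is $\psi_-(x\otimes y)=\Theta_-(\psi_-(x)\otimes\psi_-(y))$ on tensor products, with $\Theta_-=\sum_{k\ge0}q^{k(k-1)/2}\frac{(q-q^{-1})^k}{[k]!}E^k\otimes F^k$; and $\Upsilon_-=\sum_{n\ge0}\overline{c_n}\,E^n/[n]!$ with $c_{-1}=0$, $c_0=1$, $c_n=-q^{-(n-1)}(q-q^{-1})(q[n-1]c_{n-2}+c_{n-1})$, where $\overline{\phantom{c}}$ is the substitution $q\mapsto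 q^{-1}$. The diagram of $\mathbf k\in I_{\mathbf m}$ is obtained as follows. Write, for $i=1,\dots,n$ from left to right, $(m_i+k_i)/2$ up arrows followed by $(m_i-k_i)/2$ down arrows. Repeatedly connect a down arrow and an up arrow that are adjacent in this order (ignoring arrows already connected) by an arc, until all remaining up arrows are to the left of all remaining down arrows. Put a star on the rightmost remaining down arrow, if there is one, and connect the other remaining down arrows in adjacent pairs, starting from the right, by dashed arcs; at most one (the leftmost) is then unpaired. Let $n_\uparrow$ be the number of remaining up arrows, and put $N_{\mathbf k}=n_\uparrow+1$ if there is no starred down arrow, $N_{\mathbf k}=n_\uparrow$ if there is a starred but no unpaired down arrow, and $N_{\mathbf k}=-(n_\uparrow+1)$ if there are both. For $j\in\mathbb Z$ let $M_j$ be the number of $\mathbf k\in I_{\mathbf m}$ with $N_{\mathbf k}=j$. **Theorem.** The eigenvalues of $Y$ on $V$ are exactly the $[j]$, $j\in\mathbb Z$, with $M_j>0$, and the eigenspace of $Y$ for $[j]$ has dimension $M_j$ for every $j\in\mathbb Z$. The matrix of $Y$ with respect to the dual canonical basis has characteristic polynomial $\prod_{\mathbf k\in I_{\mathbf m}}(x-[N_{\mathbf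 k}])$, and for every $j\in\mathbb Z$ its eigenvalue $[j]$ has geometric and algebraic multiplicity $M_j$ (multiplicity $0$ meaning that $[j]$ is not an eigenvalue). -/

import Mathlib

open scoped TensorProduct

noncomputable section

namespace QuantumCoideal

/-! ### The ground field and quantum integers -/

/-- The field `ℂ(q)` of rational functions in an indeterminate `q`. -/
abbrev Cq : Type := RatFunc ℂ

/-- The indeterminate `q`. -/
def q : Cq := RatFunc.X

/-- The bar involution of `ℂ(q)`: the substitution `q ↦ q⁻¹`. -/
def bar (x : Cq) : Cq := RatFunc.eval (algebraMap ℂ Cq) q⁻¹ x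

/-- The quantum integer `[j] = (q ^ j - q ^ (-j)) / (q - q⁻¹)`. -/
def qInt (j : ℤ) : Cq := (q ^ j - q ^ (-j)) / (q - q⁻¹)

/-- The quantum factorial `[k]! = [1] [2] ⋯ [k]`. -/
def qFactorial (k : ℕ) : Cq := ∏ i ∈ Finset.range k, qInt ((i : ℤ) + 1)

/-! ### The irreducible representation `V_a`

`V_a` has the canonical basis `v_k`, `k = a, a - 2, …, -a`.  The index `d : Fin (a + 1)` stands for
the weight `k = a - 2 d`. -/

/-- The matrix of `E` in the canonical basis: `E v_k = [(a + k) / 2 + 1] v_{k + 2}`,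
where `(a + k) / 2 = a - d`. -/
def canonicalE (a : ℕ) : Matrix (Fin (a + 1)) (Fin (a + 1)) Cq :=
  Matrix.of fun c d => if (c : ℕ) + 1 = d then qInt ((a : ℤ) - d + 1) else 0

/-- The matrix of `F` in the canonical basis: `F v_k = [(a - k) / 2 + 1] v_{k - 2}`,
where `(a - k) / 2 = d`. -/
def canonicalF (a : ℕ) : Matrix (Fin (a + 1)) (Fin (a + 1)) Cq :=
  Matrix.of fun c d => if (c : ℕ) = d + 1 then qInt ((d : ℤ) + 1) else 0

/-- The representation `V_a`, in coordinates with respect to the basis `v^k` dual to the canonical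
basis `v_k` for the symmetric form with `⟨E u, v⟩ = ⟨u, F v⟩`, `⟨K u, v⟩ = ⟨u, K v⟩`,
`⟨v_a, v_a⟩ = 1`.  Since `⟨v_k, v^l⟩ = δ`, the matrix of `E` (of `F`) in the basis `v^k` is the
transpose of the matrix of `F` (of `E`) in the basis `v_k`. -/
abbrev Irr (a : ℕ) : Type := Fin (a + 1) → Cq

/-- `E` on `V_a`. -/
def irrE (a : ℕ) : Module.End Cq (Irr a) := Matrix.toLin' (canonicalF a).transpose

/-- `F` on `V_a`. -/
def irrF (a : ℕ) : Module.End Cq (Irr a) := Matrix.toLin' (canonicalE a).transpose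

/-- `K` on `V_a`: `K v^k = q ^ k v^k`. -/
def irrK (a : ℕ) : Module.End Cq (Irr a) :=
  Matrix.toLin' (Matrix.diagonal fun d => q ^ ((a : ℤ) - 2 * d))

/-- `K⁻¹` on `V_a`: `K⁻¹ v^k = q ^ (-k) v^k`. -/
def irrKinv (a : ℕ) : Module.End Cq (Irr a) :=
  Matrix.toLin' (Matrix.diagonal fun d => q ^ (-((a : ℤ) - 2 * d)))

/-! ### Tensor products -/

/-- `V_{m_1} ⊗ (V_{m_2} ⊗ ( ⋯ ⊗ (V_{m_n} ⊗ ℂ(q))))` as a vector space. -/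
def Tensor : List ℕ → ModuleCat.{0} Cq
  | [] => ModuleCat.of Cq Cq
  | a :: m => ModuleCat.of Cq (Irr a ⊗[Cq] Tensor m)

/-- The index set `I_m` of all `(k_1, …, k_n)` with `-m_i ≤ k_i ≤ m_i` and `k_i ≡ m_i` mod 2;
as above, `d_i : Fin (m_i + 1)` stands for `k_i = m_i - 2 d_i`. -/
def Idx : List ℕ → Type
  | [] => Unit
  | a :: m => Fin (a + 1) × Idx m

instance instDecidableEqIdx : (m : List ℕ) → DecidableEq (Idx m)
  | [] => inferInstanceAs (DecidableEq Unit)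
  | a :: m =>
    have := instDecidableEqIdx m
    inferInstanceAs (DecidableEq (Fin (a + 1) × Idx m))

instance instFintypeIdx : (m : List ℕ) → Fintype (Idx m)
  | [] => inferInstanceAs (Fintype Unit)
  | a :: m =>
    have := instFintypeIdx m
    inferInstanceAs (Fintype (Fin (a + 1) × Idx m))

/-- The standard basis `v^{k_1} ⊗ ⋯ ⊗ v^{k_n}`. -/
def stdBasis : (m : List ℕ) → Module.Basis (Idx m) Cq (Tensor m)
  | [] => Module.Basis.singleton Unit Cq
  | a :: m => (Pi.basisFun Cq (Fin (a + 1))).tensorProduct (stdBasis m)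

/-- `K`, with comultiplication `Δ₋(K) = K ⊗ K` and counit `1`. -/
def opK : (m : List ℕ) → Module.End Cq (Tensor m)
  | [] => (1 : Module.End Cq Cq)
  | a :: m => TensorProduct.map (irrK a) (opK m)

/-- `K⁻¹`, with comultiplication `Δ₋(K⁻¹) = K⁻¹ ⊗ K⁻¹` and counit `1`. -/
def opKinv : (m : List ℕ) → Module.End Cq (Tensor m)
  | [] => (1 : Module.End Cq Cq)
  | a :: m => TensorProduct.map (irrKinv a) (opKinv m)

/-- `E`, with comultiplication `Δ₋(E) = E ⊗ K⁻¹ + 1 ⊗ E` and counit `0`. -/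
def opE : (m : List ℕ) → Module.End Cq (Tensor m)
  | [] => (0 : Module.End Cq Cq)
  | a :: m => TensorProduct.map (irrE a) (opKinv m) + TensorProduct.map LinearMap.id (opE m)

/-- `F`, with comultiplication `Δ₋(F) = F ⊗ 1 + K ⊗ F` and counit `0`. -/
def opF : (m : List ℕ) → Module.End Cq (Tensor m)
  | [] => (0 : Module.End Cq Cq)
  | a :: m => TensorProduct.map (irrF a) LinearMap.id + TensorProduct.map (irrK a) (opF m)

/-- The generator `Y = F + q⁻¹ K E + K` of the coideal subalgebra, acting on the tensor product. -/
def opY (m : List ℕ) : Module.End Cq (Tensor m) :=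
  opF m + q⁻¹ • (opK m * opE m) + opK m

/-! ### The bar involution of the coideal subalgebra and dual canonical bases -/

/-- The quasi-`R`-matrix `Θ₋ = ∑_k q^{k(k-1)/2} (q - q⁻¹)^k / [k]! E^k ⊗ F^k` on
`V_a ⊗ (V_{m_1} ⊗ ⋯ ⊗ V_{m_n})`; note that `E^k = 0` on `V_a` for `k > a`. -/
def theta (a : ℕ) (m : List ℕ) : Module.End Cq (Irr a ⊗[Cq] Tensor m) :=
  ∑ k ∈ Finset.range (a + 1),
    (q ^ (k * (k - 1) / 2) * (q - q⁻¹) ^ k / qFactorial k) •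
      TensorProduct.map (irrE a ^ k) (opF m ^ k)

/-- The iterated quasi-`R`-matrix `Θ₋^{(n)} = (1 ⊗ Δ₋^{n-2})(Θ₋) · Θ₋^{(n-1)}_{2,…,n}`. -/
def thetaIter : (m : List ℕ) → Module.End Cq (Tensor m)
  | [] => (1 : Module.End Cq Cq)
  | a :: m => theta a m * TensorProduct.map LinearMap.id (thetaIter m)

/-- The antilinear map `ψ ⊗ ⋯ ⊗ ψ` fixing every standard basis vector. -/
def psiStd (m : List ℕ) (x : Tensor m) : Tensor m :=
  ∑ k, bar ((stdBasis m).repr x k) • stdBasis m k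

/-- The coefficients `c_n` of the intertwiner: `c_0 = 1`, `c_{-1} = 0` and
`c_n = -q^{-(n-1)} (q - q⁻¹) (q [n-1] c_{n-2} + c_{n-1})`. -/
def coeffC : ℕ → Cq
  | 0 => 1
  | 1 => -(q - q⁻¹)
  | n + 2 => -q ^ (-((n : ℤ) + 1)) * (q - q⁻¹) * (q * qInt ((n : ℤ) + 1) * coeffC n + coeffC (n + 1))

/-- The intertwiner `Υ₋ = ∑_n bar(c_n) E^n / [n]!`; note that `E^n = 0` on
`V_{m_1} ⊗ ⋯ ⊗ V_{m_n}` for `n > m_1 + ⋯ + m_n`. -/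
def upsilon (m : List ℕ) : Module.End Cq (Tensor m) :=
  ∑ n ∈ Finset.range (m.sum + 1), (bar (coeffC n) / qFactorial n) • opE m ^ n

/-- The antilinear bar involution `ψ^ι₋ = Υ₋ ∘ ψ₋`, where `ψ₋ = Θ₋^{(n)} ∘ (ψ ⊗ ⋯ ⊗ ψ)`. -/
def psiIota (m : List ℕ) (x : Tensor m) : Tensor m :=
  upsilon m (thetaIter m (psiStd m x))

/-- `b` is the dual canonical basis of the coideal subalgebra: every `b k` is fixed by `ψ^ι₋`, and
`b k - v^{k_1} ⊗ ⋯ ⊗ v^{k_n}` has its coordinates in `q⁻¹ ℤ[q⁻¹]`. -/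
def IsDualCanonicalBasis (m : List ℕ) (b : Module.Basis (Idx m) Cq (Tensor m)) : Prop :=
  ∀ k, psiIota m (b k) = b k ∧
    ∀ l, ∃ p : Polynomial ℤ,
      (stdBasis m).repr (b k - stdBasis m k) l = q⁻¹ * Polynomial.aeval q⁻¹ p

/-! ### Diagrams -/

/-- Up and down arrows. -/
inductive Arrow
  | up
  | down

/-- The sequence of arrows of `v^{k_1} ⊗ ⋯ ⊗ v^{k_n}`: for each `i` from left to right,
`(m_i + k_i) / 2 = m_i - d_i` up arrows followed by `(m_i - k_i) / 2 = d_i` down arrows. -/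
def arrows : (m : List ℕ) → Idx m → List Arrow
  | [], _ => []
  | a :: m, k =>
    List.replicate (a - (k.1 : ℕ)) Arrow.up ++ List.replicate (k.1 : ℕ) Arrow.down ++ arrows m k.2

/-- The positions of the arcs and of the not yet connected up and down arrows
(the rightmost ones first). -/
structure Arcs where
  arcs : List (ℕ × ℕ)
  ups : List ℕ
  downs : List ℕ

/-- Put an arrow at position `p`, to the right of everything else.  An up arrow is connected by an
arc with the nearest free down arrow on its left, if there is one. -/
def Arcs.push (s : Arcs) (p : ℕ) : Arrow → Arcs
  | Arrow.down => { s with downs := p :: s.downs }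
  | Arrow.up =>
    match s.downs with
    | [] => { s with ups := p :: s.ups }
    | d :: ds => { s with arcs := (d, p) :: s.arcs, downs := ds }

/-- Read a sequence of arrows, the first one being at position `p`. -/
def Arcs.read (s : Arcs) (p : ℕ) : List Arrow → Arcs
  | [] => s
  | x :: w => (s.push p x).read (p + 1) w

/-- Connect adjacent down arrows by dashed arcs, beginning at the right (the list has the rightmost
arrow first); at most one arrow, the leftmost one, remains unpaired. -/
def pairDowns : List ℕ → List (ℕ × ℕ) × Option ℕ
  | [] => ([], none)
  | [d] => ([], some d)
  | d :: e :: ds => ((e, d) :: (pairDowns ds).1, (pairDowns ds).2)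

/-- A diagram: arcs, up arrows, the down arrow with a star, dashed arcs, the unpaired down arrow. -/
structure Diagram where
  arcs : List (ℕ × ℕ)
  ups : List ℕ
  star : Option ℕ
  dashed : List (ℕ × ℕ)
  unpaired : Option ℕ

/-- The diagram of the dual canonical basis vector with index `k`: connect down-up pairs by arcs
until all remaining up arrows are to the left of all remaining down arrows, put a star on the
rightmost remaining down arrow, and pair the others from the right by dashed arcs. -/
def diagram (m : List ℕ) (k : Idx m) : Diagram :=
  let s := Arcs.read ⟨[], [], []⟩ 1 (arrows m k)
  { arcs := s.arcs
    ups := s.ups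
    star := s.downs.head?
    dashed := (pairDowns s.downs.tail).1
    unpaired := (pairDowns s.downs.tail).2 }

/-- The integer attached to a diagram with `n` up arrows: `n + 1` if there is no star, `n` if there
is a star but no unpaired down arrow, and `-(n + 1)` if there are both. -/
def Diagram.eigenIndex (D : Diagram) : ℤ :=
  match D.star, D.unpaired with
  | none, _ => (D.ups.length : ℤ) + 1
  | some _, none => (D.ups.length : ℤ)
  | some _, some _ => -((D.ups.length : ℤ) + 1)

/-- `N_k`. -/
def eigenIndex (m : List ℕ) (k : Idx m) : ℤ := (diagram m k).eigenIndex

/-- `M_j`, the number of `k ∈ I_m` with `N_k = j`. -/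
def indexCount (m : List ℕ) (j : ℤ) : ℕ :=
  (Finset.univ.filter fun k : Idx m => eigenIndex m k = j).card

end QuantumCoideal

end

/-!
The generator `Y` satisfies `Δ(Y) = (F + q⁻¹ K E) ⊗ 1 + K ⊗ Y` (`opY_tmul`).  Hence, if `Y w = [j] w`,
then `Y` preserves `V_a ⊗ w` and acts there as `F + q⁻¹ K E + [j] K` acts on `V_a`.  The latter has
the `a + 1` distinct eigenvalues `[j + a], [j + a - 2], …, [j - a]` (`exists_irr_eigenbasis`):
eigenvectors on `V_{a + 1}` arise from those on `V_a` by projecting `V_1 ⊗ V_a` to `V_{a + 1}`, one for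
each of the two eigenvectors of the factor `V_1` (`IsEigenSeq.step`).  By induction on the number of
factors, `Y` has an eigenbasis indexed by `I_m`, with eigenvalues `[1 + k_1 + ⋯ + k_n]`
(`exists_eigenbasis`).

It remains to see that the integers `N_k` agree with the integers `1 + k_1 + ⋯ + k_n` as multisets
(`sum_eigenIndex`).  The integer `N_k` depends only on the numbers `(u, d)` of free up and down arrows.
Reading the arrows of a factor `V_a` obeys a Clebsch–Gordan rule (`sum_clebschGordan`): the states with
`u + d = r`, combined with the `a + 1` basis vectors of `V_a`, give each state with
`u + d = r + a - 2 c` exactly once, for `0 ≤ c ≤ min r a`, and `u - d` is additive.  This reduces the claim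
to a single string `u + d = r`, where both sides are `r + 1, r - 1, …, 1 - r` (`sum_stateIndex`).

Since the characteristic polynomial and the dimensions of eigenspaces do not depend on the basis, the
eigenbasis determines them for the dual canonical basis as well.
-/

namespace QuantumCoideal

/-! ### Quantum integers -/

lemma q_ne_zero : q ≠ 0 := RatFunc.X_ne_zero

lemma q_pow_ne_one {n : ℕ} (hn : n ≠ 0) : q ^ n ≠ 1 := by
  intro h
  have h' : algebraMap (Polynomial ℂ) Cq (Polynomial.X ^ n) = algebraMap (Polynomial ℂ) Cq 1 := by
    simpa [q] using h
  have h2 := congrArg Polynomial.natDegree (RatFunc.algebraMap_injective ℂ h')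
  simp at h2
  exact hn h2

lemma q_zpow_eq_one {n : ℤ} (h : q ^ n = 1) : n = 0 := by
  obtain ⟨k, rfl | rfl⟩ := n.eq_nat_or_neg
  · by_contra hk
    exact q_pow_ne_one (n := k) (by simpa using hk) (by simpa using h)
  · by_contra hk
    exact q_pow_ne_one (n := k) (by simpa using hk) (by simpa using h)

lemma q_sub_inv_ne_zero : q - q⁻¹ ≠ 0 := by
  intro h
  refine q_pow_ne_one (n := 2) two_ne_zero ?_
  have hq := q_ne_zero
  field_simp at h
  linear_combination h

/-- Quantum integers are distinct because `q` is not a root of unity. -/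
lemma qInt_injective : Function.Injective qInt := by
  intro i j h
  have hq := q_ne_zero
  have h1 : q ^ i - q ^ (-i) = q ^ j - q ^ (-j) :=
    (div_left_inj' q_sub_inv_ne_zero).mp h
  have h2 : (q ^ (i - j) - 1) * (q ^ (i + j) + 1) = 0 := by
    rw [zpow_neg, zpow_neg] at h1
    rw [zpow_sub₀ hq, zpow_add₀ hq]
    have := zpow_ne_zero i hq
    have := zpow_ne_zero j hq
    field_simp at h1 ⊢
    linear_combination h1
  rcases mul_eq_zero.mp h2 with h3 | h3
  · have := q_zpow_eq_one (sub_eq_zero.mp h3)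
    omega
  · have h4 : q ^ (i + j) = -1 := by linear_combination h3
    have h5 : q ^ (2 * (i + j)) = 1 := by
      rw [mul_comm, zpow_mul, h4]; norm_num
    have h6 : i + j = 0 := by have := q_zpow_eq_one h5; omega
    rw [h6, zpow_zero] at h4
    norm_num at h4

lemma qInt_zero : qInt 0 = 0 := by simp [qInt]

lemma qInt_one : qInt 1 = 1 := by
  simp [qInt, div_self q_sub_inv_ne_zero]

lemma qInt_add_one (j : ℤ) : qInt (j + 1) = q * qInt j + q ^ (-j) := by
  have hq := q_ne_zero
  have h := q_sub_inv_ne_zero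
  have := zpow_ne_zero j hq
  rw [qInt, qInt, div_eq_iff h, add_mul, mul_assoc, div_mul_cancel₀ _ h, zpow_neg, zpow_neg,
    zpow_add_one₀ hq]
  field_simp
  ring

lemma qInt_add_one' (j : ℤ) : qInt (j + 1) = q⁻¹ * qInt j + q ^ j := by
  have hq := q_ne_zero
  have h := q_sub_inv_ne_zero
  have := zpow_ne_zero j hq
  rw [qInt, qInt, div_eq_iff h, add_mul, mul_assoc, div_mul_cancel₀ _ h, zpow_neg, zpow_neg,
    zpow_add_one₀ hq]
  field_simp
  ring

/-! ### Eigenvectors on a single factor -/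

/-- The three-term recurrence saying that `∑ d, p d • v^(a - 2 d)` is an eigenvector of
`F + q⁻¹ K E + [j] K` on `V_a` with eigenvalue `[l]`.  The coefficients are extended by zero to all
integers: since `[0] = 0`, the recurrence then also holds outside `0 ≤ d ≤ a`. -/
structure IsEigenSeq (a : ℕ) (j l : ℤ) (p : ℤ → Cq) : Prop where
  zero_of_neg : ∀ d < 0, p d = 0
  zero_of_gt : ∀ d > (a : ℤ), p d = 0
  apply_zero : p 0 = 1
  recurrence : ∀ d, qInt (a - d + 1) * p (d - 1) + q ^ ((a : ℤ) - 2 * d - 1) * qInt (d + 1) * p (d + 1)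
    + qInt j * q ^ ((a : ℤ) - 2 * d) * p d = qInt l * p d

/-- The step `V_1 ⊗ V_a → V_{a + 1}`: the eigenvector `v^1 + c v^(-1)` of `F + q⁻¹ K E + [l] K` on
`V_1`, tensored with an eigenvector for `[l]` on `V_a`, is projected to `V_{a + 1}`, and
`v^1 ⊗ v^(a - 2 d) ↦ v^(a + 1 - 2 d)`, `v^(-1) ⊗ v^(a - 2 d) ↦ q ^ (d - a) v^(a - 1 - 2 d)` under the
projection. -/
lemma IsEigenSeq.step {a : ℕ} {j l l' : ℤ} {p : ℤ → Cq} (h : IsEigenSeq a j l p) (c : Cq)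
    (h₁ : qInt l' = q * qInt l + c) (h₂ : c * qInt l' = c * q⁻¹ * qInt l + 1) :
    IsEigenSeq (a + 1) j l' fun d => p d + c * q ^ (d - 1 - a) * p (d - 1) where
  zero_of_neg d hd := by simp [h.zero_of_neg d hd, h.zero_of_neg (d - 1) (by omega)]
  zero_of_gt d hd := by
    push_cast at hd
    simp [h.zero_of_gt d (by omega), h.zero_of_gt (d - 1) (by omega)]
  apply_zero := by simp [h.apply_zero, h.zero_of_neg]
  recurrence d := by
    have hq := q_ne_zero
    have e₀ := h.recurrence d
    have e₁ := h.recurrence (d - 1)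
    have f₀ := qInt_add_one' d
    have f₁ := qInt_add_one (a - d + 1)
    rw [show (a : ℤ) - (d - 1) + 1 = a - d + 1 + 1 by ring, show d - 1 + 1 = d by ring] at e₁
    push_cast
    rw [show (a : ℤ) + 1 - d + 1 = a - d + 1 + 1 by ring, show d + 1 - 1 = d by ring]
    have hA := zpow_ne_zero (a : ℤ) hq
    have hD := zpow_ne_zero d hq
    simp only [zpow_add₀ hq, zpow_sub₀ hq, zpow_neg, zpow_one, two_mul, mul_sub] at *
    generalize q ^ (a : ℤ) = A at *
    generalize q ^ d = D at *
    rw [f₁] at e₁ ⊢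
    rw [f₀] at e₀ ⊢
    linear_combination (norm := (field_simp; ring)) q * e₀ + c * (D / (A * q ^ 2)) * e₁ - p d * h₁
      - D / (A * q) * p (d - 1) * h₂

lemma exists_isEigenSeq (j : ℤ) (a i : ℕ) (hi : i ≤ a) :
    ∃ p, IsEigenSeq a j (j + a - 2 * i) p := by
  have hq := q_ne_zero
  induction a generalizing i with
  | zero =>
    obtain rfl : i = 0 := by omega
    refine ⟨fun d => if d = 0 then 1 else 0, ?_, ?_, ?_, ?_⟩
    · intro d hd; simp [hd.ne]
    · intro d hd; simp only [gt_iff_lt, Nat.cast_zero] at hd; simp [hd.ne']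
    · simp
    · intro d
      rcases eq_or_ne d 0 with rfl | h0
      · simp
      · rcases eq_or_ne d 1 with rfl | h1
        · simp [qInt_zero]
        · rcases eq_or_ne d (-1) with rfl | h2
          · simp [qInt_zero]
          · simp [h0, show d - 1 ≠ 0 by omega, show d + 1 ≠ 0 by omega]
  | succ a ih =>
    rcases Nat.lt_or_ge a i with h | h
    · obtain rfl : i = a + 1 := by omega
      obtain ⟨p, hp⟩ := ih a le_rfl
      have e₁ := qInt_add_one' (j + a - 2 * a - 1)
      have e₂ := qInt_add_one (j + a - 2 * a - 1)
      rw [sub_add_cancel] at e₁ e₂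
      generalize hl : j + (a : ℤ) - 2 * a = l at *
      have h := hp.step (l' := l - 1) (-q ^ l) ?_ ?_
      · rw [show j + ((a + 1 : ℕ) : ℤ) - 2 * ((a + 1 : ℕ) : ℤ) = l - 1 by push_cast; omega]
        exact ⟨_, h⟩
      · rw [e₁, zpow_sub_one₀ hq]; field_simp; ring
      · rw [e₂, show -(l - 1) = 1 - l by ring, zpow_sub₀ hq]
        have := zpow_ne_zero l hq
        field_simp; ring
    · obtain ⟨p, hp⟩ := ih i h
      generalize hl : j + (a : ℤ) - 2 * i = l at *
      have h := hp.step (l' := l + 1) (q ^ (-l)) (qInt_add_one l) ?_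
      · rw [show j + ((a + 1 : ℕ) : ℤ) - 2 * (i : ℤ) = l + 1 by push_cast; omega]
        exact ⟨_, h⟩
      · rw [qInt_add_one', zpow_neg]
        have := zpow_ne_zero l hq
        field_simp

lemma irrE_apply (a : ℕ) (x : Irr a) (d : Fin (a + 1)) :
    irrE a x d = qInt (d + 1) * (if h : (d : ℕ) + 1 < a + 1 then x ⟨d + 1, h⟩ else 0) := by
  simp only [irrE, Matrix.toLin'_apply, Matrix.mulVec, dotProduct, Matrix.transpose_apply,
    canonicalF, Matrix.of_apply, ite_mul, zero_mul]
  split_ifs with h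
  · rw [Finset.sum_eq_single ⟨d + 1, h⟩]
    · simp
    · intro b _ hb
      exact if_neg fun hb' => hb (Fin.ext hb')
    · simp
  · rw [mul_zero]
    refine Finset.sum_eq_zero fun b _ => if_neg ?_
    omega

lemma irrF_apply (a : ℕ) (x : Irr a) (d : Fin (a + 1)) :
    irrF a x d = qInt (a - d + 1) * (if h : 0 < (d : ℕ) then x ⟨d - 1, by omega⟩ else 0) := by
  simp only [irrF, Matrix.toLin'_apply, Matrix.mulVec, dotProduct, Matrix.transpose_apply,
    canonicalE, Matrix.of_apply, ite_mul, zero_mul]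
  split_ifs with h
  · rw [Finset.sum_eq_single ⟨d - 1, by omega⟩]
    · simp [show (d : ℕ) - 1 + 1 = d by omega]
    · intro b _ hb
      refine if_neg fun hb' => hb (Fin.ext ?_)
      simp only
      omega
    · simp
  · rw [mul_zero]
    refine Finset.sum_eq_zero fun b _ => if_neg ?_
    omega

lemma irrK_apply (a : ℕ) (x : Irr a) (d : Fin (a + 1)) :
    irrK a x d = q ^ ((a : ℤ) - 2 * d) * x d := by
  simp [irrK, Matrix.mulVec_diagonal]

lemma IsEigenSeq.apply_eq {a : ℕ} {j l : ℤ} {p : ℤ → Cq} (h : IsEigenSeq a j l p) :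
    (irrF a + q⁻¹ • (irrK a * irrE a) + qInt j • irrK a) (fun d : Fin (a + 1) => p d) =
      qInt l • fun d : Fin (a + 1) => p d := by
  have hq := q_ne_zero
  ext d
  have e := h.recurrence d
  have h₁ : (if h : (d : ℕ) + 1 < a + 1 then p ((⟨d + 1, h⟩ : Fin (a + 1)) : ℕ) else 0)
      = p (d + 1) := by
    split_ifs with hd
    · simp
    · exact (h.zero_of_gt _ (by omega)).symm
  have h₂ : (if h : 0 < (d : ℕ) then p ((⟨d - 1, by omega⟩ : Fin (a + 1)) : ℕ) else 0)
      = p (d - 1) := by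
    split_ifs with hd
    · simp [Nat.cast_sub (show 1 ≤ (d : ℕ) from hd)]
    · exact (h.zero_of_neg _ (by omega)).symm
  simp only [LinearMap.add_apply, LinearMap.smul_apply, Module.End.mul_apply, Pi.add_apply,
    Pi.smul_apply, smul_eq_mul, irrF_apply, irrK_apply, irrE_apply]
  rw [h₁, h₂, ← e, zpow_sub_one₀ hq]
  ring

/-- `F + q⁻¹ K E + [j] K` is diagonalizable on `V_a`, with the `a + 1` distinct eigenvalues
`[j + a], [j + a - 2], …, [j - a]`. -/
lemma exists_irr_eigenbasis (a : ℕ) (j : ℤ) : ∃ e : Module.Basis (Fin (a + 1)) Cq (Irr a), ∀ i,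
    (irrF a + q⁻¹ • (irrK a * irrE a) + qInt j • irrK a) (e i) =
      qInt (j + (a - 2 * (i : ℕ))) • e i := by
  choose p hp using fun i : Fin (a + 1) => exists_isEigenSeq j a i (by omega)
  have hli : LinearIndependent Cq fun (i d : Fin (a + 1)) => p i d := by
    refine Module.End.eigenvectors_linearIndependent'
      (irrF a + q⁻¹ • (irrK a * irrE a) + qInt j • irrK a)
      (fun i : Fin (a + 1) => qInt (j + a - 2 * (i : ℕ))) ?_ _ fun i => ?_
    · intro i i' h
      have := qInt_injective h
      ext
      omega
    · refine Module.End.hasEigenvector_iff.mpr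
        ⟨Module.End.mem_eigenspace_iff.mpr (hp i).apply_eq, fun h0 => ?_⟩
      have := congrFun h0 0
      simp [(hp i).apply_zero] at this
  refine ⟨basisOfLinearIndependentOfCardEqFinrank hli (by simp), fun i => ?_⟩
  rw [coe_basisOfLinearIndependentOfCardEqFinrank, (hp i).apply_eq, add_sub_assoc]

/-! ### Counting diagrams -/

/-- The numbers of free up and of free down arrows. -/
def Arcs.free (s : Arcs) : ℕ × ℕ := (s.ups.length, s.downs.length)

lemma Arcs.read_append (w w' : List Arrow) (s : Arcs) (p : ℕ) :
    s.read p (w ++ w') = (s.read p w).read (p + w.length) w' := by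
  induction w generalizing s p with
  | nil => rfl
  | cons x w ih =>
    simp only [List.cons_append, Arcs.read, ih, List.length_cons]
    congr 1
    omega

lemma Arcs.free_read_replicate_up (n : ℕ) (s : Arcs) (p : ℕ) :
    (s.read p (List.replicate n Arrow.up)).free =
      (s.free.1 + (n - s.free.2), s.free.2 - n) := by
  induction n generalizing s p with
  | zero => simp [Arcs.read, Arcs.free]
  | succ n ih =>
    rw [List.replicate_succ, Arcs.read, ih]
    rcases s with ⟨_, _, _ | ⟨d, ds⟩⟩
    · simp [Arcs.push, Arcs.free]; omega
    · simp [Arcs.push, Arcs.free]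

lemma Arcs.free_read_replicate_down (n : ℕ) (s : Arcs) (p : ℕ) :
    (s.read p (List.replicate n Arrow.down)).free = (s.free.1, s.free.2 + n) := by
  induction n generalizing s p with
  | zero => simp [Arcs.read, Arcs.free]
  | succ n ih =>
    rw [List.replicate_succ, Arcs.read, ih]
    simp [Arcs.push, Arcs.free]; omega

/-- The numbers of free up and down arrows after the arrows of `k` have been read, if `s` gives
these numbers at the start. -/
def finalState : (m : List ℕ) → Idx m → ℕ × ℕ → ℕ × ℕ
  | [], _, s => s
  | a :: m, k, s =>
    finalState m k.2 (s.1 + ((a - (k.1 : ℕ)) - s.2), s.2 - (a - (k.1 : ℕ)) + (k.1 : ℕ))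

lemma free_read_arrows (m : List ℕ) (k : Idx m) (s : Arcs) (p : ℕ) :
    (s.read p (arrows m k)).free = finalState m k s.free := by
  induction m generalizing s p with
  | nil => rfl
  | cons a m ih =>
    rw [arrows, Arcs.read_append, ih, Arcs.read_append, Arcs.free_read_replicate_down,
      Arcs.free_read_replicate_up, finalState]

/-- The integer attached to a diagram with `s.1` free up and `s.2` free down arrows. -/
def stateIndex (s : ℕ × ℕ) : ℤ :=
  if s.2 = 0 then s.1 + 1 else if s.2 % 2 = 1 then s.1 else -(s.1 + 1)

lemma pairDowns_eq_none_iff : ∀ l : List ℕ, (pairDowns l).2 = none ↔ l.length % 2 = 0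
  | [] => by simp [pairDowns]
  | [d] => by simp [pairDowns]
  | d :: e :: ds => by 
    simp only [pairDowns, pairDowns_eq_none_iff ds, List.length_cons]
    omega

lemma eigenIndex_eq (m : List ℕ) (k : Idx m) :
    eigenIndex m k = stateIndex (finalState m k (0, 0)) := by
  have h := free_read_arrows m k ⟨[], [], []⟩ 1
  rw [show Arcs.free ⟨[], [], []⟩ = (0, 0) from rfl] at h
  rw [← h, eigenIndex, diagram]
  generalize Arcs.read ⟨[], [], []⟩ 1 (arrows m k) = s
  rcases s with ⟨A, U, _ | ⟨d, D⟩⟩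
  · simp [Diagram.eigenIndex, stateIndex, Arcs.free]
  · have hD := pairDowns_eq_none_iff D
    rw [show (Arcs.free ⟨A, U, d :: D⟩) = (U.length, D.length + 1) from rfl]
    simp only [Diagram.eigenIndex, stateIndex, List.head?_cons, List.tail_cons]
    rcases hp : (pairDowns D).2 with _ | x
    · have := hD.mp hp
      simp only
      rw [if_neg (by omega), if_pos (by omega)]
    · have : ¬ D.length % 2 = 0 := fun h0 => by simp [hD.mpr h0] at hp
      simp only
      rw [if_neg (by omega), if_neg (by omega)]

/-- The weight `k_1 + ⋯ + k_n`. -/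
def weight : (m : List ℕ) → Idx m → ℤ
  | [], _ => 0
  | a :: m, k => ((a : ℤ) - 2 * (k.1 : ℕ)) + weight m k.2

/-- The integers attached to the states with `r` free arrows are `r + 1, r - 1, …, -r + 1`: these
are the eigenvalue indices on `V_r`. -/
lemma sum_stateIndex {M : Type*} [AddCommMonoid M] (f : ℤ → M) (r : ℕ) :
    ∑ t ∈ Finset.range (r + 1), f (stateIndex (r - t, t)) =
      ∑ t ∈ Finset.range (r + 1), f (1 + ((r : ℤ) - 2 * t)) := by
  -- Odd `t` has index `r - t = 1 + (r - 2 s)` for `s = (t + 1) / 2`; even `t > 0` has index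
  -- `-(r - t + 1) = 1 + (r - 2 s)` for `s = r + 1 - t / 2`.
  refine Finset.sum_nbij' (fun t => if t % 2 = 1 then (t + 1) / 2 else if t = 0 then 0
      else r + 1 - t / 2)
    (fun s => if s = 0 then 0 else if 2 * s ≤ r + 1 then 2 * s - 1 else 2 * (r + 1 - s))
    ?_ ?_ ?_ ?_ ?_
  · intro t ht
    rw [Finset.mem_range] at *
    split_ifs <;> omega
  · intro t ht
    rw [Finset.mem_range] at *
    split_ifs <;> omega
  · intro t ht
    rw [Finset.mem_range] at *
    split_ifs <;> omega
  · intro t ht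
    rw [Finset.mem_range] at *
    split_ifs <;> omega
  · intro t ht
    rw [Finset.mem_range] at ht
    congr 1
    simp only [stateIndex]
    split_ifs <;> push_cast <;> omega

/-- The Clebsch–Gordan rule for diagrams: the states with `r` free arrows, followed by the arrows
of a factor `V_a`, give each state with `r + a - 2 c` free arrows once, for each `c ≤ min r a`.
Here `c` is the number of new arcs. -/
lemma sum_clebschGordan {M : Type*} [AddCommMonoid M] (G : ℕ → ℕ → M) (r a : ℕ) :
    ∑ t ∈ Finset.range (r + 1), ∑ d ∈ Finset.range (a + 1),
        G (r - t + ((a - d) - t)) (t - (a - d) + d) =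
      ∑ c ∈ Finset.range (min r a + 1), ∑ e ∈ Finset.range (r + a - 2 * c + 1),
        G (r + a - 2 * c - e) e := by
  rw [Finset.sum_sigma', Finset.sum_sigma']
  -- Given `c`, the pairs `(t, d)` with `min t (a - d) = c` form the hook `t = c` or `d = a - c`.
  refine Finset.sum_nbij' (fun x => ⟨min x.1 (a - x.2), x.1 - (a - x.2) + x.2⟩)
    (fun y => if y.2 ≤ a - y.1 then ⟨y.1, y.2⟩ else ⟨y.2 + 2 * y.1 - a, a - y.1⟩)
    ?_ ?_ ?_ ?_ ?_
  · rintro ⟨t, d⟩ h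
    simp only [Finset.mem_sigma, Finset.mem_range] at *
    omega
  · rintro ⟨c, e⟩ h
    simp only [Finset.mem_sigma, Finset.mem_range] at *
    split_ifs <;> simp only <;> omega
  · rintro ⟨t, d⟩ h
    simp only [Finset.mem_sigma, Finset.mem_range] at *
    split_ifs <;> simp only [Sigma.mk.injEq, heq_eq_eq] <;> omega
  · rintro ⟨c, e⟩ h
    simp only [Finset.mem_sigma, Finset.mem_range] at *
    split_ifs <;> simp only [Sigma.mk.injEq, heq_eq_eq] <;> omega
  · rintro ⟨t, d⟩ h
    simp only [Finset.mem_sigma, Finset.mem_range] at *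
    congr 1
    omega

lemma sum_idx_cons {M : Type*} [AddCommMonoid M] (a : ℕ) (m : List ℕ) (g : ℕ → Idx m → M) :
    ∑ k : Idx (a :: m), g (k.1 : ℕ) k.2 = ∑ d ∈ Finset.range (a + 1), ∑ k : Idx m, g d k := by
  rw [← Fin.sum_univ_eq_sum_range (fun d => ∑ k : Idx m, g d k)]
  exact Fintype.sum_prod_type (fun x : Fin (a + 1) × Idx m => g x.1 x.2)

/-- The sum over all start states with `r` free arrows is what makes induction on `m` possible: a
single start state is not preserved by the Clebsch–Gordan rule, a whole string is. -/
lemma sum_stateIndex_finalState {M : Type*} [AddCommMonoid M] (f : ℤ → M) (m : List ℕ) (r : ℕ) :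
    ∑ t ∈ Finset.range (r + 1), ∑ k : Idx m, f (stateIndex (finalState m k (r - t, t))) =
      ∑ t ∈ Finset.range (r + 1), ∑ k : Idx m, f (1 + ((r : ℤ) - 2 * t) + weight m k) := by
  induction m generalizing r with
  | nil =>
    have h (g : Idx [] → M) : ∑ k, g k = g () := Fintype.sum_unique (ι := Unit) g
    simp only [h, finalState, weight, add_zero]
    exact sum_stateIndex f r
  | cons a m ih =>
    have h₁ := sum_clebschGordan
      (fun u d => ∑ k : Idx m, f (stateIndex (finalState m k (u, d)))) r a
    have h₂ := sum_clebschGordan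
      (fun u d => ∑ k : Idx m, f (1 + ((u : ℤ) - d) + weight m k)) r a
    have h₃ (t : ℕ) := sum_idx_cons a m fun d k =>
      f (stateIndex (finalState m k (r - t + ((a - d) - t), t - (a - d) + d)))
    have h₄ (t : ℕ) := sum_idx_cons a m fun d k =>
      f (1 + ((r : ℤ) - 2 * t) + ((a : ℤ) - 2 * d + weight m k))
    simp only [finalState, weight, h₃, h₄]
    rw [h₁]
    calc _ = ∑ c ∈ Finset.range (min r a + 1), ∑ e ∈ Finset.range (r + a - 2 * c + 1),
          ∑ k : Idx m, f (1 + (((r + a - 2 * c - e : ℕ) : ℤ) - e) + weight m k) := by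
          refine Finset.sum_congr rfl fun c _ => (ih _).trans ?_
          refine Finset.sum_congr rfl fun e he => Finset.sum_congr rfl fun k _ => ?_
          rw [Finset.mem_range] at he
          congr 3
          omega
      _ = _ := h₂.symm
      _ = _ := by
          refine Finset.sum_congr rfl fun t ht => Finset.sum_congr rfl fun d hd =>
            Finset.sum_congr rfl fun k _ => ?_
          rw [Finset.mem_range] at ht hd
          congr 1
          omega

/-- The integers `N_k` are, with multiplicities, the integers `1 + k_1 + ⋯ + k_n`. -/
lemma sum_eigenIndex {M : Type*} [AddCommMonoid M] (f : ℤ → M) (m : List ℕ) :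
    ∑ k : Idx m, f (eigenIndex m k) = ∑ k : Idx m, f (1 + weight m k) := by
  simpa [eigenIndex_eq] using sum_stateIndex_finalState f m 0

lemma card_weight_eq (m : List ℕ) (j : ℤ) :
    (Finset.univ.filter fun k : Idx m => 1 + weight m k = j).card = indexCount m j := by
  rw [indexCount, Finset.card_filter, Finset.card_filter]
  exact (sum_eigenIndex (fun i => if i = j then 1 else 0) m).symm

lemma prod_eigenIndex {M : Type*} [CommMonoid M] (f : ℤ → M) (m : List ℕ) :
    ∏ k : Idx m, f (eigenIndex m k) = ∏ k : Idx m, f (1 + weight m k) :=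
  sum_eigenIndex (M := Additive M) (fun i => Additive.ofMul (f i)) m

/-! ### Diagonal bases -/

section Diagonal

variable {κ k V : Type*} [Fintype κ] [DecidableEq κ] [Field k] [AddCommGroup V] [Module k V]
  {b : Module.Basis κ k V} {T : Module.End k V} {μ : κ → k}

lemma toMatrix_eq_diagonal (h : ∀ i, T (b i) = μ i • b i) :
    LinearMap.toMatrix b b T = Matrix.diagonal μ := by
  ext i j
  rw [LinearMap.toMatrix_apply, h, map_smul, b.repr_self, Finsupp.smul_apply,
    Matrix.diagonal_apply, Finsupp.single_apply, smul_eq_mul]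
  by_cases hij : i = j
  · simp [hij]
  · simp [hij, Ne.symm hij]

lemma charpoly_toMatrix_of_diagonal (h : ∀ i, T (b i) = μ i • b i) {κ' : Type*} [Fintype κ']
    [DecidableEq κ'] (b' : Module.Basis κ' k V) :
    (LinearMap.toMatrix b' b' T).charpoly = ∏ i, (Polynomial.X - Polynomial.C (μ i)) := by
  have := Module.Finite.of_basis b
  rw [LinearMap.charpoly_toMatrix, ← LinearMap.charpoly_toMatrix T b, toMatrix_eq_diagonal h,
    Matrix.charpoly_diagonal]

lemma finrank_eigenspace_of_diagonal [DecidableEq k] (h : ∀ i, T (b i) = μ i • b i) (y : k) :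
    Module.finrank k (Module.End.eigenspace T y) = (Finset.univ.filter fun i => μ i = y).card := by
  have hspan : Module.End.eigenspace T y =
      Submodule.span k (Set.range fun i : {i // μ i = y} => b i) := by
    apply le_antisymm
    · intro x hx
      rw [Module.End.mem_eigenspace_iff] at hx
      have hcoord (i : κ) : (μ i - y) * b.repr x i = 0 := by
        have hT : b.repr (T x) i = μ i * b.repr x i := by
          have hTx : T x = ∑ i, b.repr x i • μ i • b i := by
            conv_lhs => rw [← b.sum_repr x]
            simp only [map_sum, map_smul, h]
          rw [hTx]
          simp [Finsupp.single_apply, mul_comm]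
        rw [hx, map_smul, Finsupp.smul_apply, smul_eq_mul] at hT
        linear_combination -hT
      rw [← b.sum_repr x]
      refine Submodule.sum_mem _ fun i _ => ?_
      by_cases hi : μ i = y
      · exact Submodule.smul_mem _ _ (Submodule.subset_span ⟨⟨i, hi⟩, rfl⟩)
      · rw [(mul_eq_zero.mp (hcoord i)).resolve_left (sub_ne_zero.mpr hi), zero_smul]
        exact zero_mem _
    · rw [Submodule.span_le]
      rintro _ ⟨⟨i, rfl⟩, rfl⟩
      exact Module.End.mem_eigenspace_iff.mpr (h i)
  have hli : LinearIndependent k fun i : {i // μ i = y} => b i :=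
    b.linearIndependent.comp _ Subtype.val_injective
  rw [hspan, finrank_span_eq_card hli, Fintype.card_subtype]

lemma hasEigenvalue_iff_of_diagonal (h : ∀ i, T (b i) = μ i • b i) (y : k) :
    Module.End.HasEigenvalue T y ↔ ∃ i, μ i = y := by
  classical
  have := Module.Finite.of_basis b
  rw [Module.End.hasEigenvalue_iff, ne_eq, ← Submodule.finrank_eq_zero (R := k),
    finrank_eigenspace_of_diagonal h, Finset.card_eq_zero, Finset.filter_eq_empty_iff]
  simp

end Diagonal

lemma rootMultiplicity_prod_X_sub_C {κ k : Type*} [Fintype κ] [Field k] [DecidableEq k]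
    (μ : κ → k) (y : k) :
    (∏ i, (Polynomial.X - Polynomial.C (μ i))).rootMultiplicity y =
      (Finset.univ.filter fun i => μ i = y).card := by
  rw [← Polynomial.count_roots, Polynomial.roots_prod _ _
    (Finset.prod_ne_zero_iff.mpr fun i _ => Polynomial.X_sub_C_ne_zero _)]
  simp only [Polynomial.roots_X_sub_C, Multiset.bind_singleton, Multiset.count_map, eq_comm]
  rfl

/-! ### The action of `Y` on tensor products -/

lemma irrK_mul_irrKinv (a : ℕ) : irrK a * irrKinv a = 1 := by
  have hq := q_ne_zero
  rw [irrK, irrKinv, Module.End.mul_eq_comp, ← Matrix.toLin'_mul, Matrix.diagonal_mul_diagonal]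
  simp [← zpow_add₀ hq, Module.End.one_eq_id]

lemma opK_mul_opKinv : ∀ m : List ℕ, opK m * opKinv m = 1
  | [] => mul_one _
  | a :: m => by
    refine (TensorProduct.map_mul (irrK a) (irrKinv a) (opK m) (opKinv m)).symm.trans ?_
    rw [irrK_mul_irrKinv, opK_mul_opKinv m]
    exact TensorProduct.map_one

/-- `Y` generates a coideal: `Δ(Y) = (F + q⁻¹ K E) ⊗ 1 + K ⊗ Y`. -/
lemma opY_tmul (a : ℕ) (m : List ℕ) (x : Irr a) (w : Tensor m) :
    opY (a :: m) (x ⊗ₜ[Cq] w : Irr a ⊗[Cq] Tensor m) =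
      ((irrF a + q⁻¹ • (irrK a * irrE a)) x ⊗ₜ[Cq] w + irrK a x ⊗ₜ[Cq] opY m w :
        Irr a ⊗[Cq] Tensor m) := by
  have hK : opK m (opKinv m w) = w := LinearMap.congr_fun (opK_mul_opKinv m) w
  change (irrF a x ⊗ₜ[Cq] w + irrK a x ⊗ₜ[Cq] opF m w) +
      q⁻¹ • (TensorProduct.map (irrK a) (opK m)
        (irrE a x ⊗ₜ[Cq] opKinv m w + x ⊗ₜ[Cq] opE m w)) +
      irrK a x ⊗ₜ[Cq] opK m w = _
  simp only [map_add, TensorProduct.map_tmul, hK, opY, LinearMap.add_apply, LinearMap.smul_apply,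
    Module.End.mul_apply, TensorProduct.tmul_add, TensorProduct.add_tmul, smul_add,
    TensorProduct.tmul_smul, TensorProduct.smul_tmul']
  abel

lemma opY_tmul_of_eigen (a : ℕ) (m : List ℕ) {w : Tensor m} {j l : ℤ} {x : Irr a}
    (hw : opY m w = qInt j • w)
    (hx : (irrF a + q⁻¹ • (irrK a * irrE a) + qInt j • irrK a) x = qInt l • x) :
    opY (a :: m) (x ⊗ₜ[Cq] w : Irr a ⊗[Cq] Tensor m) =
      (qInt l • (x ⊗ₜ[Cq] w) : Irr a ⊗[Cq] Tensor m) := by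
  rw [opY_tmul, hw, TensorProduct.tmul_smul, TensorProduct.smul_tmul', ← TensorProduct.add_tmul,
    TensorProduct.smul_tmul', ← hx]
  rfl

/-- `Y` is diagonalizable, with eigenvalues `[1 + k_1 + ⋯ + k_n]`. -/
lemma exists_eigenbasis : ∀ m : List ℕ, ∃ b : Module.Basis (Idx m) Cq (Tensor m),
    ∀ k, opY m (b k) = qInt (1 + weight m k) • b k
  | [] => by
    refine ⟨stdBasis [], fun k => ?_⟩
    rw [weight, add_zero, qInt_one, one_smul]
    exact (show ∀ x : Cq, (0 : Cq) + q⁻¹ • (0 : Cq) + x = x from fun x => by simp) _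
  | a :: m => by
    obtain ⟨b, hb⟩ := exists_eigenbasis m
    choose e he using fun k : Idx m => exists_irr_eigenbasis a (1 + weight m k)
    let v : Fin (a + 1) × Idx m → Irr a ⊗[Cq] Tensor m := fun k => e k.2 k.1 ⊗ₜ b k.2
    -- The first factor of `v` runs through a basis of `V_a` that depends on the second factor.
    have hv : ⊤ ≤ Submodule.span Cq (Set.range v) := by
      have hxb (k : Idx m) (x : Irr a) : x ⊗ₜ b k ∈ Submodule.span Cq (Set.range v) := by
        rw [← (e k).sum_repr x, TensorProduct.sum_tmul]
        refine Submodule.sum_mem _ fun i _ => ?_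
        rw [← TensorProduct.smul_tmul']
        exact Submodule.smul_mem _ _ (Submodule.subset_span ⟨(i, k), rfl⟩)
      rw [← TensorProduct.span_tmul_eq_top, Submodule.span_le]
      rintro _ ⟨x, w, rfl⟩
      rw [← b.sum_repr w, TensorProduct.tmul_sum]
      refine Submodule.sum_mem _ fun k _ => ?_
      rw [TensorProduct.tmul_smul]
      exact Submodule.smul_mem _ _ (hxb k x)
    have hcard : Fintype.card (Fin (a + 1) × Idx m) =
        Module.finrank Cq (Irr a ⊗[Cq] Tensor m) :=
      (Module.finrank_eq_card_basis ((Pi.basisFun Cq (Fin (a + 1))).tensorProduct b)).symm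
    refine ⟨basisOfTopLeSpanOfCardEqFinrank v hv hcard, fun k => ?_⟩
    have hbk : (basisOfTopLeSpanOfCardEqFinrank v hv hcard : _ → _) k = v k :=
      congrFun (coe_basisOfTopLeSpanOfCardEqFinrank v hv hcard) k
    have hk := opY_tmul_of_eigen a m (hb k.2) (he k.2 k.1)
    rw [show 1 + weight (a :: m) k = 1 + weight m k.2 + (a - 2 * (k.1 : ℕ)) by
      rw [weight]; ring]
    exact (congrArg (opY (a :: m)) hbk).trans (hk.trans
      (congrArg (fun z : Irr a ⊗[Cq] Tensor m => qInt (1 + weight m k.2 + (a - 2 * (k.1 : ℕ))) • z)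
        hbk.symm))

end QuantumCoideal

open QuantumCoideal in
theorem mainTheorem2 (m : List ℕ) (hm : ∀ a ∈ m, 0 < a) :
    ((∀ j : ℤ,
        Module.finrank QuantumCoideal.Cq
            (Module.End.eigenspace (QuantumCoideal.opY m) (QuantumCoideal.qInt j)) =
          QuantumCoideal.indexCount m j) ∧
      ∀ y : QuantumCoideal.Cq,
        Module.End.HasEigenvalue (QuantumCoideal.opY m) y ↔
          ∃ j : ℤ, y = QuantumCoideal.qInt j ∧ 0 < QuantumCoideal.indexCount m j) ∧
    ∀ b : Module.Basis (QuantumCoideal.Idx m) QuantumCoideal.Cq (QuantumCoideal.Tensor m),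
      QuantumCoideal.IsDualCanonicalBasis m b →
        (LinearMap.toMatrix b b (QuantumCoideal.opY m)).charpoly =
            ∏ k : QuantumCoideal.Idx m,
              (Polynomial.X -
                Polynomial.C (QuantumCoideal.qInt (QuantumCoideal.eigenIndex m k))) ∧
          ∀ j : ℤ,
            Module.finrank QuantumCoideal.Cq
                (Module.End.eigenspace
                  (Matrix.toLin' (LinearMap.toMatrix b b (QuantumCoideal.opY m)))
                  (QuantumCoideal.qInt j)) =
              QuantumCoideal.indexCount m j ∧
            (LinearMap.toMatrix b b (QuantumCoideal.opY m)).charpoly.rootMultiplicity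
                (QuantumCoideal.qInt j) =
              QuantumCoideal.indexCount m j := by
  classical
  obtain ⟨e, he⟩ := exists_eigenbasis m
  have hcard (j : ℤ) :
      (Finset.univ.filter fun k => qInt (1 + weight m k) = qInt j).card = indexCount m j := by
    simp only [qInt_injective.eq_iff, card_weight_eq]
  refine ⟨⟨fun j => ?_, fun y => ?_⟩, fun b _ => ⟨?_, fun j => ⟨?_, ?_⟩⟩⟩
  · rw [finrank_eigenspace_of_diagonal he, hcard]
  · rw [hasEigenvalue_iff_of_diagonal he]
    simp only [← card_weight_eq, Finset.card_pos]
    constructor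
    · rintro ⟨k, rfl⟩
      exact ⟨_, rfl, k, by simp⟩
    · rintro ⟨j, rfl, k, hk⟩
      exact ⟨k, by rw [(Finset.mem_filter.mp hk).2]⟩
  · rw [charpoly_toMatrix_of_diagonal he]
    exact (prod_eigenIndex (fun i => Polynomial.X - Polynomial.C (qInt i)) m).symm
  · -- The coordinates in the basis `b` carry `e` to an eigenbasis of the matrix.
    rw [finrank_eigenspace_of_diagonal (b := e.map b.equivFun)
      (μ := fun k => qInt (1 + weight m k)) (fun k => ?_), hcard]
    rw [Module.Basis.map_apply, ← map_smul, ← he, Matrix.toLin'_apply]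
    exact LinearMap.toMatrix_mulVec_repr b b (opY m) (e k)
  · rw [charpoly_toMatrix_of_diagonal he, rootMultiplicity_prod_X_sub_C, hcard]
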